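/- **Setting.** For $q\in L^2([0,1])$ put $\eta(q)(x)=\exp\int_0^x q$ and $\varphi(q)(x)=\int_0^x\eta(q)$. Let $Q=\{q\in L^2([0,1]) : \int_0^1 q=0,\ \int_0^1\eta(q)=1\}$, with tangent space $T_qQ=\{X\in L^2 : \int_0^1 X=\int_0^1 X\varphi(q)=0\}$ and metric $G(q)(X,X)=\int_0^1 X^2/\eta(q)$; via $q=\partial_x\log\partial_x\varphi$ this is the group $\mathrm{Diff}_0^2([0,1])$ with its right-invariant $H^2_0$ metric. Identify $T_q^*Q$ with $\{p\in L^2:\eta(q)p\in T_qQ\}$, with norm $\|p\|_q^2=\int_0^1\eta(q)p^2$, and let $$\pi_q^*(f)=f-\begin{bmatrix}1&\varphi\end{bmatrix}H_2^{-1}\begin{bmatrix}\int_0^1\eta f\\ \int_0^1\eta\varphi f\end{bmatrix},\qquad H_2=\begin{bmatrix}1&1/2\\1/2&1/3\end{bmatrix}.$$ Put $\mathcal U(m,q)(x)=\frac12\int_x^1\eta(q)\,dm$ for a function or a measure $m$ on $[0,1]$, $\pi_1(p,q)=\begin{bmatrix}1&\varphi\end{bmatrix}H_2^{-1}\begin{bmatrix}0\\b\end{bmatrix}$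 with $b=\frac32\int_0^1\eta(x)\big(\int_0^x\eta p\,dy\big)^2dx$, and $\pi_2(q,f)=(\mathrm{id}-\pi_q^*)(\mathcal U(f,q))$. Given $(p_0,q_0)$, let $\mathcal C^0$ be the set of curves $(p(t),q(t))_{t\in[0,1]}$ with $q(t)\in Q$, $p(t)\in T^*_{q(t)}Q$, $q\in H^2([0,1],L^2([0,1]))$, $\dot q=\eta(q)p$, $q(0)=q_0$, $p(0)=p_0$; given also $(p_1,q_1)$, let $\mathcal C^{0,1}$ be the subset of those with $q(1)=q_1$, $p(1)=p_1$. Let $\mathcal C$ denote either of these sets. The covariant acceleration of such a curve is, as a covector, $\big(\frac D{Dt}\dot q\big)^\flat=\dot p+\mathcal U(p^2,q)-\pi_1(p,q)-\pi_2(q,p^2)$; the curve is a geodesic if it solves $\dot q=\eta(q)p$, $\dot p=-\mathcal U(p^2,q)+\pi_1(p,q)+\pi_2(q,p^2)$ on $[0,1]$. Let $D=[0,1]^2$ with variables $(t,x)$. For a finite positive measure $\mu$ and a finite signed measure $\nu$ on $D$ and a positive continuous $f$, put $\mathrm{FR}_f(\mu,\nu)=\int_D r\big(\frac{d\mu}{d\lambda},\frac{d\nu}{d\lambda}\big)f\,d\lambda$,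 where $\lambda$ is any measure dominating $\mu$ and $|\nu|$, and $r(x,y)=\frac{y^2}{4x}$ if $x>0$, $r(0,0)=0$, $r=+\infty$ otherwise. Let $\mathcal M_0(D)$ be the set of finite positive measures $\Delta$ on $D$ with $\Delta_{t=0}=0$, where the conditions $\Delta_{t=0}=0$ and $\partial_t\Delta=\delta\in\mathcal M(D)$ (signed) are understood weakly: $\langle\partial_tf,\Delta\rangle+\langle f,\delta\rangle=0$ for all $f\in C^0(D)$ that are $C^1$ in $t$ and satisfy $f(1,\cdot)=0$. For a functional $P$ of $(p(1),q(1))$ with real values, let $$\mathcal F(\Delta,p,q)=\mathrm{FR}_{\eta(q)}(\Delta,\partial_t\Delta)+\int_0^1\Big\|\Big(\frac D{Dt}\dot q\Big)^\flat+\pi_q^*(\mathcal U(\Delta_t,q))\Big\|_q^2dt+P(p(1),q(1)),$$ where $\Delta=\Delta_t\,dt$, and $\mathcal F=+\infty$ if $\partial_t\Delta$ is not a measure. **Statement.** For every geodesic $(p,q)\in\mathcal C$, the curve $q$ belongs to $C^2([0,1],L^2([0,1]))$, and there is an open neighborhood $U$ of $q$ in $C^2([0,1],L^2([0,1]))$ such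 that for every $(\tilde p,\tilde q)\in\mathcal C$ with $\tilde q\in U$ the functional $\Delta\mapsto\mathcal F(\Delta,\tilde p,\tilde q)$ attains its minimum over $\mathcal M_0(D)$ at $\Delta=0$. That is, the set of paths $(p,q)\in\mathcal C$ such that $\mathcal F$ has an optimum with respect to $\Delta$ at $\Delta=0$ contains an open neighborhood of every geodesic in the $C^2([0,1],L^2([0,1]))$ topology. -/

import Mathlib

open MeasureTheory Set
open scoped ENNReal

namespace DiffSpline

noncomputable section

/-! ### The Hilbert manifold `Q`, its cotangent bundle and its metric -/

/-- The Hilbert space `L²([0,1])` of functions of the space variable. -/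
abbrev L2 : Type := Lp ℝ 2 (volume.restrict (Icc (0 : ℝ) 1))

/-- The Jacobian `η(q)(x) = exp (∫₀ˣ q)`. -/
def eta (q : L2) (x : ℝ) : ℝ := Real.exp (∫ y in (0 : ℝ)..x, q y)

/-- The diffeomorphism `φ(q)(x) = ∫₀ˣ η(q)`. -/
def phi (q : L2) (x : ℝ) : ℝ := ∫ y in (0 : ℝ)..x, eta q y

/-- The submanifold `Q` of `L²([0,1])`, which represents `Diff₀²([0,1])` through
`q = ∂ₓ log ∂ₓφ`. -/
def Q : Set L2 :=
  {q | (∫ x in (0 : ℝ)..1, q x) = 0 ∧ (∫ x in (0 : ℝ)..1, eta q x) = 1}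

/-- The cotangent space `T_q^*Q`: the `p` such that `X = η(q) p` lies in the tangent space
`T_qQ = {X | ∫ X = 0, ∫ X φ(q) = 0}`.  (The metric on `T_qQ` is `G(q)(X,X) = ∫ X² / η(q)`, so
`X = η(q) p` is the vector with dual `p`, and the dual norm is `‖p‖_q² = ∫ η(q) p²`.) -/
def cotangent (q : L2) : Set L2 :=
  {p | (∫ x in (0 : ℝ)..1, eta q x * p x) = 0 ∧
       (∫ x in (0 : ℝ)..1, eta q x * p x * phi q x) = 0}

/-- The Gram matrix of `1, φ` for `⟨f, g⟩_η = ∫ η f g`. -/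
def H2 : Matrix (Fin 2) (Fin 2) ℝ := !![1, 1 / 2; 1 / 2, 1 / 3]

/-- The function `[1 φ] H₂⁻¹ [α; β]`. -/
def lift (q : L2) (α β : ℝ) (x : ℝ) : ℝ :=
  ![1, phi q x] ⬝ᵥ (H2⁻¹.mulVec ![α, β])

/-- The orthogonal projection `π_q^*` onto `T_q^*Q`. -/
def projStar (q : L2) (f : ℝ → ℝ) (x : ℝ) : ℝ :=
  f x - lift q (∫ y in (0 : ℝ)..1, eta q y * f y) (∫ y in (0 : ℝ)..1, eta q y * f y * phi q y) x

/-- The nonlocal operator `𝒰(m, q)(x) = ½ ∫_{[x,1]} η(q) dm` on measures in the space variable. -/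
def nonlocalMeas (m : Measure ℝ) (q : L2) (x : ℝ) : ℝ :=
  (1 / 2) * ∫ y in Icc x 1, eta q y ∂m

/-- The nonlocal operator `𝒰(f, q)(x) = ½ ∫ₓ¹ η(q) f` on functions. -/
def nonlocal (f : ℝ → ℝ) (q : L2) (x : ℝ) : ℝ :=
  (1 / 2) * ∫ y in x..1, eta q y * f y

/-- `b = (3/2) ∫₀¹ (∫₀ˣ p ∘ φ⁻¹)² dx`, written after the change of variable `φ`. -/
def coefB (p q : L2) : ℝ :=
  (3 / 2) * ∫ x in (0 : ℝ)..1, eta q x * (∫ y in (0 : ℝ)..x, eta q y * p y) ^ 2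

/-- `π₁(p, q) = [1 φ] H₂⁻¹ [0; b]`. -/
def proj1 (p q : L2) (x : ℝ) : ℝ := lift q 0 (coefB p q) x

/-- `π₂(q, f) = (id - π_q^*) (𝒰(f, q))`. -/
def proj2 (q : L2) (f : ℝ → ℝ) (x : ℝ) : ℝ :=
  nonlocal f q x - projStar q (nonlocal f q) x

/-! ### Paths in `T^*Q` -/

/-- A time-dependent pair `(p, q)`; only the times in `[0,1]` matter. -/
structure Path where
  p : ℝ → L2
  q : ℝ → L2

/-- `q ∈ H²([0,1], L²([0,1]))`: `q` has an `L²` second derivative `a`. -/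
def MemH2 (q : ℝ → L2) : Prop :=
  ∃ v a : ℝ → L2, MemLp a 2 (volume.restrict (Icc (0 : ℝ) 1)) ∧
    ∀ t ∈ Icc (0 : ℝ) 1,
      v t = v 0 + ∫ s in (0 : ℝ)..t, a s ∧ q t = q 0 + ∫ s in (0 : ℝ)..t, v s

/-- The first Hamilton equation `q̇ = η(q) p` on `[0,1]`. -/
def FirstEquation (γ : Path) : Prop :=
  ∀ t ∈ Icc (0 : ℝ) 1, ∃ v : L2, HasDerivWithinAt γ.q v (Icc 0 1) t ∧
    v =ᵐ[volume.restrict (Icc (0 : ℝ) 1)] fun x => eta (γ.q t) x * γ.p t x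

/-- The curves `(p, q)` in `T^*Q` with `q ∈ H²([0,1], L²)`, `q̇ = η(q) p`, `q(0) = q₀`,
`p(0) = p₀`. -/
def curves0 (p₀ q₀ : L2) : Set Path :=
  {γ | MemH2 γ.q ∧ (∀ t ∈ Icc (0 : ℝ) 1, γ.q t ∈ Q ∧ γ.p t ∈ cotangent (γ.q t)) ∧
    FirstEquation γ ∧ γ.q 0 = q₀ ∧ γ.p 0 = p₀}

/-- The curves as in `curves0`, with in addition `q(1) = q₁` and `p(1) = p₁`. -/
def curves01 (p₀ q₀ p₁ q₁ : L2) : Set Path :=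
  {γ | γ ∈ curves0 p₀ q₀ ∧ γ.q 1 = q₁ ∧ γ.p 1 = p₁}

/-- `(D/Dt q̇)^♭ = ṗ + 𝒰(p², q) - π₁(p, q) - π₂(q, p²)` at time `t`: the covariant acceleration of
the curve in `Q`, as a covector. -/
def acceleration (γ : Path) (t x : ℝ) : ℝ :=
  (derivWithin γ.p (Icc 0 1) t : L2) x + nonlocal (fun y => (γ.p t y) ^ 2) (γ.q t) x
    - proj1 (γ.p t) (γ.q t) x - proj2 (γ.q t) (fun y => (γ.p t y) ^ 2) x

/-- The geodesic equation on `Q` in Hamiltonian form: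
`q̇ = η(q) p`, `ṗ = -𝒰(p², q) + π₁(p, q) + π₂(q, p²)` on `[0,1]`. -/
def IsGeodesic (γ : Path) : Prop :=
  FirstEquation γ ∧
  ∀ t ∈ Icc (0 : ℝ) 1, ∃ r : L2, HasDerivWithinAt γ.p r (Icc 0 1) t ∧
    r =ᵐ[volume.restrict (Icc (0 : ℝ) 1)] fun x =>
      -nonlocal (fun y => (γ.p t y) ^ 2) (γ.q t) x + proj1 (γ.p t) (γ.q t) x
        + proj2 (γ.q t) (fun y => (γ.p t y) ^ 2) x

/-! ### The Fisher-Rao functional -/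

/-- The space-time domain, with variables `(t, x)`. -/
def D : Set (ℝ × ℝ) := Icc (0 : ℝ) 1 ×ˢ Icc (0 : ℝ) 1

/-- The one-homogeneous convex function `r(x, y) = y² / (4x)`. -/
def frDensity (x y : ℝ) : ℝ≥0∞ :=
  if 0 < x then ENNReal.ofReal (y ^ 2 / (4 * x)) else if x = 0 ∧ y = 0 then 0 else ⊤

/-- `FR_f(μ, ν) = ∫ r(dμ/dλ, dν/dλ) f dλ`, with the dominating measure `λ = μ + |ν|`; by
homogeneity of `r` the value is the same for every dominating measure. -/
def fisherRao (f : ℝ × ℝ → ℝ) (μ : Measure (ℝ × ℝ)) (ν : SignedMeasure (ℝ × ℝ)) : ℝ≥0∞ :=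
  ∫⁻ z, frDensity (μ.rnDeriv (μ + ν.totalVariation) z).toReal (ν.rnDeriv (μ + ν.totalVariation) z)
    * ENNReal.ofReal (f z) ∂(μ + ν.totalVariation)

/-- The integral of a function against a signed measure. -/
def signedIntegral (ν : SignedMeasure (ℝ × ℝ)) (f : ℝ × ℝ → ℝ) : ℝ :=
  (∫ z, f z ∂ν.toJordanDecomposition.posPart) - ∫ z, f z ∂ν.toJordanDecomposition.negPart

/-- `f ∈ C_{1,0}(D)`, with time derivative `f'`. -/
def MemC10 (f f' : ℝ × ℝ → ℝ) : Prop :=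
  ContinuousOn f D ∧ ContinuousOn f' D ∧
    ∀ t ∈ Icc (0 : ℝ) 1, ∀ x ∈ Icc (0 : ℝ) 1,
      HasDerivWithinAt (fun s => f (s, x)) (f' (t, x)) (Icc 0 1) t

/-- The signed measure `δ` on `D` is `∂_t Δ`, and `Δ` vanishes at time `0`, in the weak sense:
`⟨∂_t f, Δ⟩ + ⟨f, δ⟩ = 0` for all `f ∈ C_{1,0}(D)` with `f(1, ·) = 0`. -/
def IsTimeDerivZeroInit (Δ : Measure (ℝ × ℝ)) (δ : SignedMeasure (ℝ × ℝ)) : Prop :=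
  δ.totalVariation Dᶜ = 0 ∧
  ∀ f f' : ℝ × ℝ → ℝ, MemC10 f f' → (∀ x ∈ Icc (0 : ℝ) 1, f (1, x) = 0) →
    (∫ z, f' z ∂Δ) + signedIntegral δ f = 0

/-- `FR_f(Δ, ∂_t Δ)` for `Δ` vanishing at time `0`, and `+∞` if `Δ` does not vanish at time `0` or
`∂_t Δ` is not a measure.  (The weak equation determines `δ` except on `{t = 1}`, where `Δ` has no
mass, so that a finite value forces `δ` to vanish there.) -/
def fisherRaoTime (f : ℝ × ℝ → ℝ) (Δ : Measure (ℝ × ℝ)) : ℝ≥0∞ :=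
  ⨅ (δ : SignedMeasure (ℝ × ℝ)) (_ : IsTimeDerivZeroInit Δ δ), fisherRao f Δ δ

/-! ### The relaxed functional -/

/-- The disintegration `Δ = Δ_t dt` with respect to time.  A `Δ` with `fisherRaoTime f Δ < ∞` has a
time marginal that is absolutely continuous. -/
def slice (Δ : Measure (ℝ × ℝ)) [IsFiniteMeasure Δ] (t : ℝ) : Measure ℝ :=
  Δ.fst.rnDeriv volume t • Δ.condKernel t

/-- The relaxed acceleration functional
`ℱ(Δ, p, q) = FR_η(Δ, ∂_t Δ) + ∫₀¹ ‖(D/Dt q̇)^♭ + π_q^*(𝒰(Δ, q))‖_q² dt + P(p(1), q(1))`. -/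
def relaxedFunctional (P : L2 → L2 → ℝ) (γ : Path)
    (Δ : Measure (ℝ × ℝ)) [IsFiniteMeasure Δ] : EReal :=
  ((fisherRaoTime (fun z => eta (γ.q z.1) z.2) Δ
    + ∫⁻ t in Icc (0 : ℝ) 1, ∫⁻ x in Icc (0 : ℝ) 1, ENNReal.ofReal
        (eta (γ.q t) x *
          (acceleration γ t x
            + projStar (γ.q t) (nonlocalMeas (slice Δ t) (γ.q t)) x) ^ 2) : ℝ≥0∞) : EReal)
  + ((P (γ.p 1) (γ.q 1) : ℝ) : EReal)

/-- `ℱ(·, p, q)` is minimal at `Δ = 0` among the finite positive measures on `D` (those that do not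
vanish at time `0` have `ℱ = +∞`). -/
def OptimalAtZero (P : L2 → L2 → ℝ) (γ : Path) : Prop :=
  ∀ (Δ : Measure (ℝ × ℝ)) [IsFiniteMeasure Δ], Δ Dᶜ = 0 →
    relaxedFunctional P γ 0 ≤ relaxedFunctional P γ Δ

/-! ### The `C²([0,1], L²([0,1]))` topology -/

/-- The curves that are `C²` on `[0,1]` with values in `L²([0,1])`. -/
def C2Curve : Type := {q : ℝ → L2 // ContDiffOn ℝ 2 q (Icc 0 1)}

/-- The derivatives of order `0, 1, 2`, as continuous functions on `[0,1]`. -/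
def C2Curve.jet (q : C2Curve) (k : Fin 3) : C(Icc (0 : ℝ) 1, L2) where
  toFun t := iteratedDerivWithin k q.1 (Icc 0 1) t
  continuous_toFun := by
    have h : ContinuousOn (iteratedDerivWithin (k : ℕ) q.1 (Icc (0 : ℝ) 1)) (Icc 0 1) :=
      q.2.continuousOn_iteratedDerivWithin (by
        have : (k : ℕ) ≤ 2 := by omega
        exact_mod_cast this) (uniqueDiffOn_Icc zero_lt_one)
    exact continuousOn_iff_continuous_domRestrict.1 h

/-- The `C²` topology: uniform convergence on `[0,1]` of the derivatives of order `0, 1, 2`. -/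
instance : TopologicalSpace C2Curve := TopologicalSpace.induced C2Curve.jet inferInstance

/-- `S` contains an open neighborhood of `γ` in the set of curves `C`, for the `C²` topology. -/
def ContainsC2Neighborhood (C S : Set Path) (γ : Path) : Prop :=
  ∃ (h : ContDiffOn ℝ 2 γ.q (Icc 0 1)) (U : Set C2Curve), IsOpen U ∧ (⟨γ.q, h⟩ : C2Curve) ∈ U ∧
    ∀ γ' ∈ C, ∀ h' : ContDiffOn ℝ 2 γ'.q (Icc 0 1), (⟨γ'.q, h'⟩ : C2Curve) ∈ U → γ' ∈ S

end

end DiffSpline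

namespace DiffSpline

/-! Both the gain and the loss caused by a nonzero `Δ` are linear in its mass, and near a geodesic
the gain wins.

Gain: a Poincaré inequality, `mul_mass_le_fisherRao`. Since `r` is convex and one-homogeneous, `r(x,
y) ≥ a y - a² x` for every real `a`. Taking `a` to be a function of time that vanishes at `t = 1`,
the weak equation for `∂_t Δ` turns the linear term into mass of `Δ`. With `η ≥ m` on `D`, the
Fisher-Rao term is at least `(m / 4) Δ(D)`.

Loss: let `A` be the acceleration and `u` the projected nonlocal term. Then `η A² ≤ η (A + u)² + 2 η
|A| |u|`, and `|u|` is at most a constant times the mass of `Δ_t`. If `‖A‖ ≤ ε` at all times, adding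
`Δ` lowers the quadratic term by at most `C ε Δ(D)`, with `C` depending only on bounds for `η`. So
`Δ = 0` is optimal once `C ε ≤ m / 4` (`optimalAtZero_of_small`).

Along a geodesic `A = 0`. Since `p = q̇ / η(q)`, the acceleration is a function `accel` of `(q, q̇,
q̈)`, jointly continuous on `L²` (`continuous_accel`, `acceleration_ae`). Hence `A` stays small and
`η` stays bounded, uniformly in time, on a `C²` neighborhood. -/

theorem eta_pos (q : L2) (x : ℝ) : 0 < eta q x := Real.exp_pos _

/-! ### Fisher-Rao energy controls mass. -/

theorem ofReal_integral_le_lintegral_ofReal {α : Type*} [MeasurableSpace α] {μ : Measure α}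
    {g : α → ℝ} (hg : Integrable g μ) :
    ENNReal.ofReal (∫ z, g z ∂μ) ≤ ∫⁻ z, ENNReal.ofReal (g z) ∂μ := by
  refine ENNReal.ofReal_le_of_le_toReal ?_
  rw [integral_eq_lintegral_pos_part_sub_lintegral_neg_part hg]
  exact sub_le_self _ ENNReal.toReal_nonneg

/-- The tangent planes of the convex function `r` bound it from below. -/
theorem ofReal_le_frDensity (a x y : ℝ) :
    ENNReal.ofReal (a * y - a ^ 2 * x) ≤ frDensity x y := by
  unfold frDensity
  split_ifs with h h'
  · refine ENNReal.ofReal_le_ofReal ?_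
    rw [le_div_iff₀ (by positivity)]
    nlinarith [sq_nonneg (y - 2 * a * x)]
  · simp [h'.1, h'.2]
  · exact le_top

theorem totalVariation_eq (δ : SignedMeasure (ℝ × ℝ)) :
    δ.totalVariation = δ.toJordanDecomposition.posPart + δ.toJordanDecomposition.negPart := rfl

instance (δ : SignedMeasure (ℝ × ℝ)) : IsFiniteMeasure δ.totalVariation := by
  rw [totalVariation_eq]; infer_instance

/-- Both Jordan parts are dominated by `μ + |δ|`, so each density can be integrated back to its own
measure. This converts the linear part of the tangent-plane bound into `⟨f, δ⟩`, to which the weak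
equation applies. -/
theorem integral_mul_rnDeriv_signed {μ : Measure (ℝ × ℝ)} [IsFiniteMeasure μ]
    {δ : SignedMeasure (ℝ × ℝ)} {f : ℝ × ℝ → ℝ} (hf : Integrable f δ.totalVariation) :
    Integrable (fun z => f z * δ.rnDeriv (μ + δ.totalVariation) z) (μ + δ.totalVariation) ∧
    ∫ z, f z * δ.rnDeriv (μ + δ.totalVariation) z ∂(μ + δ.totalVariation)
      = signedIntegral δ f := by
  set l := μ + δ.totalVariation with hl
  set jp := δ.toJordanDecomposition.posPart with hjp
  set jn := δ.toJordanDecomposition.negPart with hjn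
  have hp : jp ≤ δ.totalVariation := by rw [totalVariation_eq]; exact Measure.le_add_right le_rfl
  have hn : jn ≤ δ.totalVariation := by rw [totalVariation_eq]; exact Measure.le_add_left le_rfl
  have hv : δ.totalVariation ≤ l := Measure.le_add_left le_rfl
  have acp : jp ≪ l := (hp.trans hv).absolutelyContinuous
  have acn : jn ≪ l := (hn.trans hv).absolutelyContinuous
  have ip := (integrable_rnDeriv_smul_iff acp).2 (hf.mono_measure hp)
  have ineg := (integrable_rnDeriv_smul_iff acn).2 (hf.mono_measure hn)
  have e : (fun z => f z * δ.rnDeriv l z)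
      = fun z => (jp.rnDeriv l z).toReal • f z - (jn.rnDeriv l z).toReal • f z := by
    funext z
    rw [SignedMeasure.rnDeriv_def]
    simp only [smul_eq_mul]
    ring
  rw [e]
  refine ⟨ip.sub ineg, ?_⟩
  rw [integral_sub ip ineg, integral_rnDeriv_smul acp, integral_rnDeriv_smul acn]
  rfl

/-- Poincaré inequality for the Fisher-Rao functional on measures vanishing at time `0`. -/
theorem mul_mass_le_fisherRao {Δ : Measure (ℝ × ℝ)} [IsFiniteMeasure Δ] (hΔ : Δ Dᶜ = 0)
    {δ : SignedMeasure (ℝ × ℝ)} (hδ : IsTimeDerivZeroInit Δ δ) {f : ℝ × ℝ → ℝ} {m : ℝ}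
    (hm : 0 ≤ m) (hf : ∀ z ∈ D, m ≤ f z) :
    ENNReal.ofReal (m / 4) * Δ univ ≤ fisherRao f Δ δ := by
  set l := Δ + δ.totalVariation with hl
  have : IsFiniteMeasure l := by rw [hl]; infer_instance
  have hlD : ∀ᵐ z ∂l, z ∈ D := by
    rw [ae_iff]
    change l Dᶜ = 0
    simp [hl, hΔ, hδ.1]
  have hvD : ∀ᵐ z ∂δ.totalVariation, z ∈ D := by rw [ae_iff]; exact hδ.1
  have hΔD : ∀ᵐ z ∂Δ, z ∈ D := by rw [ae_iff]; exact hΔ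
  -- With `a = c (1 - t)` the linear term yields `c Δ(D)` and the quadratic one costs at most `c²
  -- Δ(D)`; `c = 1/2` maximizes `c - c²` and leaves `Δ(D) / 4`.
  let a : ℝ × ℝ → ℝ := fun z => (1 - z.1) / 2
  have ac : Continuous a := by fun_prop
  have abd : ∀ z ∈ D, ‖a z‖ ≤ 1 := by
    rintro z ⟨⟨h0, h1⟩, -⟩
    rw [Real.norm_eq_abs, abs_le]
    constructor <;> simp only [a] <;> linarith
  have iv : Integrable a δ.totalVariation :=
    Integrable.of_bound ac.aestronglyMeasurable 1 (hvD.mono abd)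
  have iΔ : Integrable (fun z => a z ^ 2) Δ := by
    refine Integrable.of_bound (by fun_prop) 1 (hΔD.mono fun z hz => ?_)
    rw [norm_pow]
    exact pow_le_one₀ (norm_nonneg _) (abd z hz)
  obtain ⟨i1, e1⟩ := integral_mul_rnDeriv_signed (μ := Δ) iv
  have acΔ : Δ ≪ l := (Measure.le_add_right le_rfl : Δ ≤ l).absolutelyContinuous
  have : Δ.HaveLebesgueDecomposition l := by
    have : SFinite Δ := instSFiniteOfSigmaFinite
    exact Measure.haveLebesgueDecomposition_of_sigmaFinite _ _
  have i2 := (integrable_rnDeriv_smul_iff acΔ).2 iΔ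
  have e2 := integral_rnDeriv_smul (f := fun z => a z ^ 2) acΔ
  have test : (∫ _, (-1 / 2 : ℝ) ∂Δ) + signedIntegral δ a = 0 := by
    refine hδ.2 a (fun _ => -1 / 2) ⟨ac.continuousOn, continuousOn_const, ?_⟩ ?_
    · intro t _ x _
      have := (((hasDerivAt_id t).const_sub 1).div_const 2).hasDerivWithinAt (s := Icc (0 : ℝ) 1)
      simpa [a] using this
    · intro x _
      simp [a]
  have key : Δ.real univ / 4 ≤ ∫ z, (a z * δ.rnDeriv l z
      - (Δ.rnDeriv l z).toReal • (a z ^ 2)) ∂l := by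
    rw [integral_sub i1 i2, e1, e2]
    have h1 : ∫ z, a z ^ 2 ∂Δ ≤ ∫ _, (1 / 4 : ℝ) ∂Δ := by
      refine integral_mono_ae iΔ (integrable_const _) (hΔD.mono ?_)
      rintro z ⟨⟨h0, h1⟩, -⟩
      simp only [a]
      nlinarith
    simp only [integral_const, smul_eq_mul] at h1 test
    linarith
  calc ENNReal.ofReal (m / 4) * Δ univ
      = ENNReal.ofReal m * ENNReal.ofReal (Δ.real univ / 4) := by
        rw [← ENNReal.ofReal_mul hm, ← ofReal_measureReal, ← ENNReal.ofReal_mul (by positivity)]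
        congr 1
        ring
    _ ≤ ENNReal.ofReal m * ∫⁻ z, ENNReal.ofReal (a z * δ.rnDeriv l z
          - (Δ.rnDeriv l z).toReal • (a z ^ 2)) ∂l := by
        gcongr
        exact (ENNReal.ofReal_le_ofReal key).trans
          (ofReal_integral_le_lintegral_ofReal (i1.sub i2))
    _ = ∫⁻ z, ENNReal.ofReal (a z * δ.rnDeriv l z
          - (Δ.rnDeriv l z).toReal • (a z ^ 2)) * ENNReal.ofReal m ∂l := by
        rw [lintegral_mul_const' _ _ ENNReal.ofReal_ne_top, mul_comm]
    _ ≤ fisherRao f Δ δ := by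
        refine lintegral_mono_ae (hlD.mono fun z hz => ?_)
        gcongr
        · refine le_trans (le_of_eq ?_)
            (ofReal_le_frDensity (a z) _ (δ.rnDeriv l z))
          rw [smul_eq_mul, mul_comm (a z ^ 2)]
        · exact hf z hz

theorem mul_mass_le_fisherRaoTime {Δ : Measure (ℝ × ℝ)} [IsFiniteMeasure Δ] (hΔ : Δ Dᶜ = 0)
    {f : ℝ × ℝ → ℝ} {m : ℝ} (hm : 0 ≤ m) (hf : ∀ z ∈ D, m ≤ f z) :
    ENNReal.ofReal (m / 4) * Δ univ ≤ fisherRaoTime f Δ :=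
  le_iInf₂ fun _ hδ => mul_mass_le_fisherRao hΔ hδ hm hf

theorem fisherRaoTime_zero (f : ℝ × ℝ → ℝ) : fisherRaoTime f 0 = 0 := by
  have hv : (0 : SignedMeasure (ℝ × ℝ)).totalVariation = 0 := SignedMeasure.totalVariation_zero
  have h0 : IsTimeDerivZeroInit 0 0 := by
    refine ⟨by simp [hv], fun f f' _ _ => ?_⟩
    simp [signedIntegral, SignedMeasure.toJordanDecomposition_zero]
  refine le_antisymm ((iInf₂_le 0 h0).trans_eq ?_) zero_le
  unfold fisherRao
  rw [hv, add_zero, lintegral_zero_measure]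

/-! ### Slices -/

theorem slice_zero_ae : ∀ᵐ t : ℝ, slice (0 : Measure (ℝ × ℝ)) t = 0 := by
  have h := Measure.rnDeriv_zero (volume : Measure ℝ)
  filter_upwards [h] with t ht
  have : (0 : Measure (ℝ × ℝ)).fst = 0 := by simp
  unfold slice
  rw [this, ht]
  simp

/-- The conditional kernel is Markov, so the slice's mass is the density of the time marginal. The
estimates use nothing else about the disintegration. -/
theorem slice_univ (Δ : Measure (ℝ × ℝ)) [IsFiniteMeasure Δ] (t : ℝ) :
    slice Δ t univ = Δ.fst.rnDeriv volume t := by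
  simp [slice]

/-! ### Sup-norm bounds for the nonlocal operator and the projection. -/

theorem H2_inv : H2⁻¹ = !![4, -6; -6, 12] := by
  refine Matrix.inv_eq_right_inv ?_
  ext i j
  fin_cases i <;> fin_cases j <;> norm_num [H2, Matrix.mul_apply]

theorem lift_eq (q : L2) (α β x : ℝ) :
    lift q α β x = (4 * α - 6 * β) + (12 * β - 6 * α) * phi q x := by
  simp only [lift, H2_inv, Matrix.mulVec, dotProduct, Fin.sum_univ_two]
  simp
  ring

/-- In the application `β` has the integrand of `α` multiplied by `φ`, and `|φ| ≤ E`, whence the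
bounds `A` and `A * E`. -/
theorem abs_lift_le {q : L2} {α β x A E : ℝ} (hE : 0 ≤ E) (hα : |α| ≤ A) (hβ : |β| ≤ A * E)
    (hφ : |phi q x| ≤ E) : |lift q α β x| ≤ A * (4 + 12 * E + 12 * E ^ 2) := by
  have hA : 0 ≤ A := (abs_nonneg _).trans hα
  have h1 : |4 * α - 6 * β| ≤ 4 * A + 6 * (A * E) := by
    rw [abs_le] at *
    constructor <;> linarith
  have h2 : |12 * β - 6 * α| ≤ 12 * (A * E) + 6 * A := by
    rw [abs_le] at *
    constructor <;> linarith
  rw [lift_eq]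
  calc _ ≤ |4 * α - 6 * β| + |12 * β - 6 * α| * |phi q x| := by
        rw [← abs_mul]; exact abs_add_le _ _
    _ ≤ (4 * A + 6 * (A * E)) + (12 * (A * E) + 6 * A) * E := by gcongr
    _ = _ := by ring

theorem abs_nonlocalMeas_le {m : Measure ℝ} [IsFiniteMeasure m] {q : L2} {E x : ℝ}
    (hE : ∀ y ∈ Icc (0 : ℝ) 1, eta q y ≤ E) (hx : x ∈ Icc (0 : ℝ) 1) :
    |nonlocalMeas m q x| ≤ E * m.real univ := by
  have hE0 : 0 ≤ E := (eta_pos _ _).le.trans (hE x hx)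
  have h := norm_setIntegral_le_of_norm_le_const (μ := m) (s := Icc x 1) (C := E)
    (f := eta q) (measure_lt_top _ _) (fun y hy => by
      rw [Real.norm_eq_abs, abs_of_pos (eta_pos q y)]
      exact hE y ⟨hx.1.trans hy.1, hy.2⟩)
  unfold nonlocalMeas
  rw [abs_mul]
  have h2 : m.real (Icc x 1) ≤ m.real univ := measureReal_mono (subset_univ _)
  rw [Real.norm_eq_abs] at h
  have h3 : E * m.real (Icc x 1) ≤ E * m.real univ := by gcongr
  have h4 := abs_nonneg (∫ y in Icc x 1, eta q y ∂m)
  rw [abs_of_pos (by norm_num : (0:ℝ) < 1 / 2)]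
  linarith

theorem abs_intervalIntegral_le_of_abs_le {g : ℝ → ℝ} {A x : ℝ} (hx : x ∈ Icc (0 : ℝ) 1)
    (hg : ∀ y ∈ Icc (0 : ℝ) 1, |g y| ≤ A) : |∫ y in (0 : ℝ)..x, g y| ≤ A := by
  have hA : 0 ≤ A := (abs_nonneg _).trans (hg x hx)
  have h := intervalIntegral.norm_integral_le_of_norm_le_const (a := 0) (b := x) (f := g) (C := A)
    (fun y hy => by
      rw [uIoc_of_le hx.1] at hy
      exact hg y ⟨hy.1.le, hy.2.trans hx.2⟩)
  rw [sub_zero, abs_of_nonneg hx.1] at h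
  exact h.trans (mul_le_of_le_one_right hA hx.2)

theorem abs_phi_le {q : L2} {E x : ℝ} (hE : ∀ y ∈ Icc (0 : ℝ) 1, eta q y ≤ E)
    (hx : x ∈ Icc (0 : ℝ) 1) : |phi q x| ≤ E :=
  abs_intervalIntegral_le_of_abs_le hx fun y hy => by
    rw [abs_of_pos (eta_pos q y)]; exact hE y hy

/-- A pointwise bound in place of contractivity in `‖·‖_q`: the factor `E` comes from the weight `η`
in the two moments, the polynomial from `abs_lift_le`. -/
theorem abs_projStar_le {q : L2} {f : ℝ → ℝ} {E A x : ℝ} (hE : ∀ y ∈ Icc (0 : ℝ) 1, eta q y ≤ E)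
    (hf : ∀ y ∈ Icc (0 : ℝ) 1, |f y| ≤ A) (hx : x ∈ Icc (0 : ℝ) 1) :
    |projStar q f x| ≤ A * (1 + E * (4 + 12 * E + 12 * E ^ 2)) := by
  have hA : 0 ≤ A := (abs_nonneg _).trans (hf x hx)
  have hE0 : 0 ≤ E := (eta_pos _ _).le.trans (hE x hx)
  have h1 : (1 : ℝ) ∈ Icc (0 : ℝ) 1 := by simp
  have hηf : ∀ y ∈ Icc (0 : ℝ) 1, |eta q y * f y| ≤ A * E := fun y hy => by
    rw [abs_mul, abs_of_pos (eta_pos q y), mul_comm]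
    exact mul_le_mul (hf y hy) (hE y hy) (eta_pos _ _).le hA
  have hl := abs_lift_le (q := q) (x := x) hE0 (abs_intervalIntegral_le_of_abs_le h1 hηf)
    (abs_intervalIntegral_le_of_abs_le h1 (g := fun y => eta q y * f y * phi q y)
      (A := A * E * E) (fun y hy => by
        rw [abs_mul]
        exact mul_le_mul (hηf y hy) (abs_phi_le hE hy) (abs_nonneg _) (by positivity)))
    (abs_phi_le hE hx)
  unfold projStar
  refine (abs_sub _ _).trans ?_
  have := hf x hx
  linarith

noncomputable section

/-! ### Operators between `L²([0,1])` and bounded continuous functions -/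

/-- Lebesgue measure on `[0,1]`. -/
abbrev unitMeasure : Measure ℝ := volume.restrict (Icc (0 : ℝ) 1)

/-- Bounded continuous functions on `ℝ`. -/
abbrev BCF : Type := BoundedContinuousFunction ℝ ℝ

/-- Integrating against the restricted measure makes primitives of `L²([0,1])` classes well defined,
continuous and bounded on all of `ℝ`, so that they live in the Banach algebra `BCF`. -/
theorem intervalIntegral_unitMeasure {f : ℝ → ℝ} {a b : ℝ} (ha : 0 ≤ a) (hab : a ≤ b)
    (hb : b ≤ 1) : ∫ y in a..b, f y ∂unitMeasure = ∫ y in a..b, f y := by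
  rw [intervalIntegral.integral_of_le hab, intervalIntegral.integral_of_le hab,
    Measure.restrict_restrict measurableSet_Ioc, inter_eq_left.2]
  exact fun y hy => ⟨ha.trans hy.1.le, hy.2.trans hb⟩

theorem intervalIntegral_congr_unitMeasure {f g : ℝ → ℝ} (h : f =ᵐ[unitMeasure] g) {a b : ℝ}
    (ha : 0 ≤ a) (hab : a ≤ b) (hb : b ≤ 1) : ∫ y in a..b, f y = ∫ y in a..b, g y := by
  rw [← intervalIntegral_unitMeasure ha hab hb, ← intervalIntegral_unitMeasure ha hab hb]
  exact intervalIntegral.integral_congr_ae (h.mono fun _ hx _ => hx)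

theorem intervalIntegrable_unitMeasure {f : ℝ → ℝ} (h : Integrable f unitMeasure) (a b : ℝ) :
    IntervalIntegrable f unitMeasure a b :=
  ⟨h.integrableOn, h.integrableOn⟩

theorem norm_primitive_le (h : Lp ℝ 1 unitMeasure) (x : ℝ) :
    ‖∫ y in (0 : ℝ)..x, h y ∂unitMeasure‖ ≤ ‖h‖ := by
  refine intervalIntegral.norm_integral_le_integral_norm_uIoc.trans ?_
  rw [L1.norm_eq_integral_norm]
  exact setIntegral_le_integral (L1.integrable_coeFn h).norm (.of_forall fun _ => norm_nonneg _)

/-- The primitive of an integrable function. -/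
def primitive : Lp ℝ 1 unitMeasure →L[ℝ] BCF :=
  LinearMap.mkContinuous
    { toFun := fun h => BoundedContinuousFunction.ofNormedAddCommGroup
        (fun x => ∫ y in (0 : ℝ)..x, h y ∂unitMeasure)
        (intervalIntegral.continuous_primitive
          (intervalIntegrable_unitMeasure (L1.integrable_coeFn h)) 0) ‖h‖ (norm_primitive_le h)
      map_add' := fun f g => by
        ext x
        have e : ∫ y in (0 : ℝ)..x, (f + g : Lp ℝ 1 unitMeasure) y ∂unitMeasure
            = ∫ y in (0 : ℝ)..x, (f y + g y) ∂unitMeasure :=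
          intervalIntegral.integral_congr_ae ((Lp.coeFn_add f g).mono fun _ hx _ => hx)
        change ∫ y in (0 : ℝ)..x, (f + g : Lp ℝ 1 unitMeasure) y ∂unitMeasure = _
        rw [e]
        exact intervalIntegral.integral_add
          (intervalIntegrable_unitMeasure (L1.integrable_coeFn f) _ _)
          (intervalIntegrable_unitMeasure (L1.integrable_coeFn g) _ _)
      map_smul' := fun c f => by
        ext x
        have e : ∫ y in (0 : ℝ)..x, (c • f : Lp ℝ 1 unitMeasure) y ∂unitMeasure
            = ∫ y in (0 : ℝ)..x, c • f y ∂unitMeasure :=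
          intervalIntegral.integral_congr_ae ((Lp.coeFn_smul c f).mono fun _ hx _ => hx)
        change ∫ y in (0 : ℝ)..x, (c • f : Lp ℝ 1 unitMeasure) y ∂unitMeasure = _
        rw [e]
        exact intervalIntegral.integral_smul _ _ } 1 fun h => by
    rw [one_mul]
    exact (BoundedContinuousFunction.norm_le (norm_nonneg _)).2 (norm_primitive_le h)

/-- Multiplication of a square integrable function by a bounded continuous one. -/
def mulL2 : BCF →L[ℝ] L2 →L[ℝ] L2 :=
  ((ContinuousLinearMap.mul ℝ ℝ).holderL unitMeasure ∞ 2 2).comp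
    (BoundedContinuousFunction.toLp ∞ unitMeasure ℝ)

theorem mulL2_ae (f : BCF) (g : L2) : mulL2 f g =ᵐ[unitMeasure] fun x => f x * g x := by
  filter_upwards [(ContinuousLinearMap.mul ℝ ℝ).coeFn_holder (r := 2)
    (BoundedContinuousFunction.toLp ∞ unitMeasure ℝ f) g,
    BoundedContinuousFunction.coeFn_toLp ∞ unitMeasure ℝ f] with x h1 h2
  rw [← h2]
  exact h1

/-- The primitive of the product of two square integrable functions. -/
def primMul : L2 →L[ℝ] L2 →L[ℝ] BCF :=
  (primitive.postcomp L2).comp ((ContinuousLinearMap.mul ℝ ℝ).holderL unitMeasure 2 2 1)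

theorem primMul_apply (f g : L2) {x : ℝ} (hx : x ∈ Icc (0 : ℝ) 1) :
    primMul f g x = ∫ y in (0 : ℝ)..x, f y * g y := by
  rw [← intervalIntegral_unitMeasure le_rfl hx.1 hx.2]
  exact intervalIntegral.integral_congr_ae
    (((ContinuousLinearMap.mul ℝ ℝ).coeFn_holder (r := 1) f g).mono fun _ h _ => h)

/-- The inclusion of bounded continuous functions. -/
def incl : BCF →L[ℝ] L2 := BoundedContinuousFunction.toLp 2 unitMeasure ℝ

theorem incl_ae (f : BCF) : incl f =ᵐ[unitMeasure] f :=
  BoundedContinuousFunction.coeFn_toLp 2 unitMeasure ℝ f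

/-- The primitive of a square integrable function. -/
def primL2 : L2 →L[ℝ] BCF := primMul (incl 1)

theorem primL2_apply (f : L2) {x : ℝ} (hx : x ∈ Icc (0 : ℝ) 1) :
    primL2 f x = ∫ y in (0 : ℝ)..x, f y := by
  refine (primMul_apply _ _ hx).trans
    (intervalIntegral_congr_unitMeasure ?_ le_rfl hx.1 hx.2)
  filter_upwards [incl_ae 1] with y hy
  rw [hy]
  exact one_mul _

theorem primL2_incl_apply (f : BCF) {x : ℝ} (hx : x ∈ Icc (0 : ℝ) 1) :
    primL2 (incl f) x = ∫ y in (0 : ℝ)..x, f y :=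
  (primL2_apply _ hx).trans (intervalIntegral_congr_unitMeasure (incl_ae f) le_rfl hx.1 hx.2)

theorem continuous_eval_BCF (x : ℝ) : Continuous fun f : BCF => f x :=
  (BoundedContinuousFunction.evalCLM ℝ x).continuous

/-- Evaluation at a point is a ring homomorphism. -/
def evalRingHom (x : ℝ) : BCF →+* ℝ where
  toFun f := f x
  map_one' := rfl
  map_mul' _ _ := rfl
  map_zero' := rfl
  map_add' _ _ := rfl

/-- Evaluation is a continuous ring homomorphism, so it commutes with the exponential series.
Continuity and derivatives of `η(q)` in `q` then follow from those of the Banach algebra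
exponential. -/
theorem exp_apply (f : BCF) (x : ℝ) : NormedSpace.exp f x = Real.exp (f x) := by
  have hc : Continuous (evalRingHom x) := continuous_eval_BCF x
  rw [Real.exp_eq_exp_ℝ]
  refine NormedSpace.map_exp_of_mem_ball (𝕂 := ℝ) (evalRingHom x) hc f ?_
  rw [NormedSpace.expSeries_radius_eq_top]
  exact edist_lt_top _ _

/-- `η(q)` as a bounded continuous function. -/
def etaB (q : L2) : BCF := NormedSpace.exp (primL2 q)

/-- `1 / η(q)` as a bounded continuous function. -/
def invEtaB (q : L2) : BCF := NormedSpace.exp (-primL2 q)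

theorem etaB_apply (q : L2) {x : ℝ} (hx : x ∈ Icc (0 : ℝ) 1) : etaB q x = eta q x := by
  rw [etaB, exp_apply, primL2_apply _ hx, eta]

theorem invEtaB_apply (q : L2) {x : ℝ} (hx : x ∈ Icc (0 : ℝ) 1) :
    invEtaB q x = (eta q x)⁻¹ := by
  rw [invEtaB, exp_apply, BoundedContinuousFunction.neg_apply, primL2_apply _ hx, eta,
    Real.exp_neg]

theorem continuous_exp_BCF : Continuous (NormedSpace.exp : BCF → BCF) :=
  NormedSpace.exp_continuous

@[fun_prop]
theorem continuous_etaB : Continuous etaB := continuous_exp_BCF.comp primL2.continuous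

@[fun_prop]
theorem continuous_invEtaB : Continuous invEtaB := continuous_exp_BCF.comp primL2.continuous.neg

theorem hasDerivWithinAt_etaB {q : ℝ → L2} {v : L2} {s : Set ℝ} {t : ℝ}
    (h : HasDerivWithinAt q v s t) :
    HasDerivWithinAt (fun t => etaB (q t)) (etaB (q t) * primL2 v) s t := by
  have h1 := primL2.hasFDerivAt.comp_hasDerivWithinAt t h
  exact (hasFDerivAt_exp (𝕂 := ℝ) (x := primL2 (q t))).comp_hasDerivWithinAt t h1

theorem hasDerivWithinAt_invEtaB {q : ℝ → L2} {v : L2} {s : Set ℝ} {t : ℝ}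
    (h : HasDerivWithinAt q v s t) :
    HasDerivWithinAt (fun t => invEtaB (q t)) (-(invEtaB (q t) * primL2 v)) s t := by
  have h1 := (primL2.hasFDerivAt.comp_hasDerivWithinAt t h).neg
  have h2 := (hasFDerivAt_exp (𝕂 := ℝ) (x := -primL2 (q t))).comp_hasDerivWithinAt t h1
  refine h2.congr_deriv ?_
  exact mul_neg (invEtaB (q t)) (primL2 v)

theorem hasDerivWithinAt_mulL2 {f : ℝ → BCF} {g : ℝ → L2} {f' : BCF} {g' : L2} {s : Set ℝ} {t : ℝ}
    (hf : HasDerivWithinAt f f' s t) (hg : HasDerivWithinAt g g' s t) :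
    HasDerivWithinAt (fun t => mulL2 (f t) (g t)) (mulL2 f' (g t) + mulL2 (f t) g') s t :=
  (mulL2.hasFDerivAt.comp_hasDerivWithinAt t hf).clm_apply hg

@[fun_prop]
theorem continuous_mulL2 {Y : Type*} [TopologicalSpace Y] {f : Y → BCF} {g : Y → L2}
    (hf : Continuous f) (hg : Continuous g) : Continuous fun y => mulL2 (f y) (g y) :=
  (mulL2.continuous.comp hf).clm_apply hg

theorem ae_unit {P : ℝ → Prop} (h : ∀ x ∈ Icc (0 : ℝ) 1, P x) : ∀ᵐ x ∂unitMeasure, P x :=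
  (ae_restrict_mem measurableSet_Icc).mono h

theorem eq_mulL2_etaB_iff {q p v : L2} :
    (v =ᵐ[unitMeasure] fun x => eta q x * p x) ↔ v = mulL2 (etaB q) p := by
  have e : mulL2 (etaB q) p =ᵐ[unitMeasure] fun x => eta q x * p x := by
    filter_upwards [mulL2_ae (etaB q) p, ae_unit fun x hx => etaB_apply q hx] with x h1 h2
    rw [h1, h2]
  exact ⟨fun h => Lp.ext (h.trans e.symm), fun h => h ▸ e⟩

/-- Only `q` is controlled by the `C²` topology; this eliminates `p` in favor of the velocity. -/
theorem eq_mulL2_invEtaB {q p v : L2} (h : v =ᵐ[unitMeasure] fun x => eta q x * p x) :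
    p = mulL2 (invEtaB q) v := by
  refine Lp.ext ?_
  filter_upwards [mulL2_ae (invEtaB q) v, h, ae_unit fun x hx => invEtaB_apply q hx]
    with x h1 h2 h3
  rw [h1, h2, h3, inv_mul_cancel_left₀ (eta_pos q x).ne']

/-! ### The acceleration as a continuous function of the two-jet -/

/-- `φ(q)` as a bounded continuous function. -/
def phiB (q : L2) : BCF := primL2 (incl (etaB q))

theorem phiB_apply (q : L2) {x : ℝ} (hx : x ∈ Icc (0 : ℝ) 1) : phiB q x = phi q x := by
  rw [phiB, primL2_incl_apply _ hx, phi]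
  exact intervalIntegral_congr_unitMeasure (ae_unit fun y hy => etaB_apply q hy) le_rfl hx.1 hx.2

/-- `lift` as a bounded continuous function. -/
def liftB (q : L2) (α β : ℝ) : BCF := (4 * α - 6 * β) • 1 + (12 * β - 6 * α) • phiB q

theorem liftB_apply (q : L2) (α β : ℝ) {x : ℝ} (hx : x ∈ Icc (0 : ℝ) 1) :
    liftB q α β x = lift q α β x := by
  rw [lift_eq, ← phiB_apply q hx]
  simp [liftB]

/-- The integral over `[0,1]`. -/
def integ (f : BCF) : ℝ := primL2 (incl f) 1

theorem one_mem_unit : (1 : ℝ) ∈ Icc (0 : ℝ) 1 := by simp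

theorem integ_eq {f : BCF} {g : ℝ → ℝ} (h : ∀ x ∈ Icc (0 : ℝ) 1, f x = g x) :
    integ f = ∫ x in (0 : ℝ)..1, g x :=
  (primL2_incl_apply f one_mem_unit).trans
    (intervalIntegral_congr_unitMeasure (ae_unit h) le_rfl zero_le_one le_rfl)

@[fun_prop]
theorem continuous_integ : Continuous integ :=
  (continuous_eval_BCF 1).comp (primL2.comp incl).continuous

/-- `𝒰(p², q)` for `p = v / η(q)`. -/
def nonlocalB (q v : L2) : BCF :=
  (1 / 2 : ℝ) • (primMul v (mulL2 (invEtaB q) v) 1 • (1 : BCF) - primMul v (mulL2 (invEtaB q) v))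

/-- `𝒰(p², q) - π₁(p, q) - π₂(q, p²)` for `p = v / η(q)`. -/
def forceB (q v : L2) : BCF :=
  nonlocalB q v - liftB q 0 (3 / 2 * integ (etaB q * primL2 v ^ 2))
    - liftB q (integ (etaB q * nonlocalB q v)) (integ (etaB q * nonlocalB q v * phiB q))

/-- The covariant acceleration as a function of `q`, `q̇` and `q̈`. -/
def accel (q v a : L2) : L2 :=
  mulL2 (invEtaB q) a - mulL2 (invEtaB q * primL2 v) v + incl (forceB q v)

@[fun_prop]
theorem continuous_nonlocalB : Continuous fun z : L2 × L2 => nonlocalB z.1 z.2 := by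
  have h : Continuous fun z : L2 × L2 => primMul z.2 (mulL2 (invEtaB z.1) z.2) :=
    (primMul.continuous.comp continuous_snd).clm_apply (by fun_prop)
  have h1 := (continuous_eval_BCF 1).comp h
  exact ((h1.smul continuous_const).sub h).const_smul (1 / 2 : ℝ)

@[fun_prop]
theorem continuous_phiB : Continuous phiB := by unfold phiB; fun_prop

theorem continuous_liftB : Continuous fun z : L2 × ℝ × ℝ => liftB z.1 z.2.1 z.2.2 := by
  unfold liftB
  fun_prop

theorem continuous_forceB : Continuous fun z : L2 × L2 => forceB z.1 z.2 := by
  unfold forceB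
  refine (continuous_nonlocalB.sub ?_).sub ?_
  · exact continuous_liftB.comp (f := fun z : L2 × L2 =>
      (z.1, (0 : ℝ), 3 / 2 * integ (etaB z.1 * primL2 z.2 ^ 2))) (by fun_prop)
  · exact continuous_liftB.comp (f := fun z : L2 × L2 =>
      (z.1, integ (etaB z.1 * nonlocalB z.1 z.2),
        integ (etaB z.1 * nonlocalB z.1 z.2 * phiB z.1))) (by fun_prop)

/-- Everything is built from bounded linear and bilinear maps between `L²` and `BCF` and the
exponential. -/
theorem continuous_accel : Continuous fun z : L2 × L2 × L2 => accel z.1 z.2.1 z.2.2 := by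
  unfold accel
  have h : Continuous fun z : L2 × L2 × L2 => forceB z.1 z.2.1 :=
    continuous_forceB.comp (f := fun z : L2 × L2 × L2 => (z.1, z.2.1)) (by fun_prop)
  fun_prop

/-- The identity `v p = η p²` makes `primMul v p` the primitive of `η p²`; the tail integral is its
total value minus its value at `x`. -/
theorem nonlocalB_apply {q v p : L2} (h : v =ᵐ[unitMeasure] fun x => eta q x * p x)
    {x : ℝ} (hx : x ∈ Icc (0 : ℝ) 1) :
    nonlocalB q v x = nonlocal (fun y => p y ^ 2) q x := by
  have hi : Integrable (fun y => v y * p y) unitMeasure :=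
    (Lp.memLp v).integrable_mul (Lp.memLp p)
  have hii := intervalIntegrable_unitMeasure hi
  have e : ∫ y in x..1, eta q y * p y ^ 2 = ∫ y in x..1, v y * p y := by
    refine intervalIntegral_congr_unitMeasure ?_ hx.1 hx.2 le_rfl
    filter_upwards [h] with y hy
    rw [hy]
    ring
  have e2 : ∫ y in x..1, v y * p y
      = (∫ y in (0 : ℝ)..1, v y * p y) - ∫ y in (0 : ℝ)..x, v y * p y := by
    rw [← intervalIntegral_unitMeasure hx.1 hx.2 le_rfl,
      ← intervalIntegral_unitMeasure le_rfl hx.1 hx.2,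
      ← intervalIntegral_unitMeasure le_rfl zero_le_one le_rfl,
      intervalIntegral.integral_interval_sub_left (hii _ _) (hii _ _)]
  rw [nonlocal, e, e2, ← primMul_apply v p hx, ← primMul_apply v p one_mem_unit, nonlocalB,
    ← eq_mulL2_invEtaB h]
  simp

theorem forceB_apply {q v p : L2} (h : v =ᵐ[unitMeasure] fun x => eta q x * p x)
    {x : ℝ} (hx : x ∈ Icc (0 : ℝ) 1) :
    forceB q v x = nonlocal (fun y => p y ^ 2) q x - proj1 p q x
      - proj2 q (fun y => p y ^ 2) x := by
  have e1 : 3 / 2 * integ (etaB q * primL2 v ^ 2) = coefB p q := by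
    unfold coefB
    congr 1
    refine integ_eq fun y hy => ?_
    rw [BoundedContinuousFunction.mul_apply, BoundedContinuousFunction.pow_apply, etaB_apply q hy,
      primL2_apply v hy, intervalIntegral_congr_unitMeasure h le_rfl hy.1 hy.2]
  have e2 : integ (etaB q * nonlocalB q v)
      = ∫ y in (0 : ℝ)..1, eta q y * nonlocal (fun y => p y ^ 2) q y :=
    integ_eq fun y hy => by
      rw [BoundedContinuousFunction.mul_apply, etaB_apply q hy, nonlocalB_apply h hy]
  have e3 : integ (etaB q * nonlocalB q v * phiB q)
      = ∫ y in (0 : ℝ)..1, eta q y * nonlocal (fun y => p y ^ 2) q y * phi q y :=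
    integ_eq fun y hy => by
      rw [BoundedContinuousFunction.mul_apply, BoundedContinuousFunction.mul_apply,
        etaB_apply q hy, nonlocalB_apply h hy, phiB_apply q hy]
  rw [forceB, BoundedContinuousFunction.sub_apply, BoundedContinuousFunction.sub_apply,
    liftB_apply _ _ _ hx, liftB_apply _ _ _ hx, nonlocalB_apply h hx, e1, e2, e3, proj2, proj1,
    projStar]
  ring

/-! ### Regularity of curves and geodesics -/

theorem uniqueDiffOn_unit : UniqueDiffOn ℝ (Icc (0 : ℝ) 1) := uniqueDiffOn_Icc zero_lt_one

theorem FirstEquation.velocity_ae {γ : Path} (hF : FirstEquation γ) {v : L2} {t : ℝ}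
    (ht : t ∈ Icc (0 : ℝ) 1) (hv : HasDerivWithinAt γ.q v (Icc 0 1) t) :
    v =ᵐ[unitMeasure] fun x => eta (γ.q t) x * γ.p t x := by
  obtain ⟨w, hw, hw'⟩ := hF t ht
  rwa [(uniqueDiffOn_unit t ht).eq_deriv _ hv hw]

/-- Differentiating `p = q̇ / η(q)` gives `ṗ = q̈ / η - (∫₀ˣ q̇) q̇ / η`, so `p` inherits its
differentiability from `q`. -/
theorem acceleration_ae {γ : Path} (hF : FirstEquation γ) {v : ℝ → L2} {a : L2} {t : ℝ}
    (ht : t ∈ Icc (0 : ℝ) 1)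
    (hq : ∀ s ∈ Icc (0 : ℝ) 1, HasDerivWithinAt γ.q (v s) (Icc 0 1) s)
    (hv : HasDerivWithinAt v a (Icc 0 1) t) :
    acceleration γ t =ᵐ[unitMeasure] accel (γ.q t) (v t) a := by
  have hp : ∀ s ∈ Icc (0 : ℝ) 1, γ.p s = mulL2 (invEtaB (γ.q s)) (v s) := fun s hs =>
    eq_mulL2_invEtaB (hF.velocity_ae hs (hq s hs))
  have hd := ((hasDerivWithinAt_mulL2 (hasDerivWithinAt_invEtaB (hq t ht)) hv).congr hp
    (hp t ht)).derivWithin (uniqueDiffOn_unit t ht)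
  have e : accel (γ.q t) (v t) a
      = derivWithin γ.p (Icc 0 1) t + incl (forceB (γ.q t) (v t)) := by
    rw [hd, accel, map_neg, neg_apply]
    abel
  rw [e]
  filter_upwards [Lp.coeFn_add (derivWithin γ.p (Icc 0 1) t) (incl (forceB (γ.q t) (v t))),
    incl_ae (forceB (γ.q t) (v t)),
    ae_unit fun x hx => forceB_apply (hF.velocity_ae ht (hq t ht)) hx] with x h1 h2 h3
  rw [h1, Pi.add_apply, h2, h3, acceleration]
  ring

theorem contDiffOn_two_of_hasDerivWithinAt {q v a : ℝ → L2}
    (hq : ∀ s ∈ Icc (0 : ℝ) 1, HasDerivWithinAt q (v s) (Icc 0 1) s)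
    (hv : ∀ s ∈ Icc (0 : ℝ) 1, HasDerivWithinAt v (a s) (Icc 0 1) s)
    (ha : ContinuousOn a (Icc 0 1)) : ContDiffOn ℝ 2 q (Icc 0 1) := by
  have dq : ∀ s ∈ Icc (0 : ℝ) 1, derivWithin q (Icc 0 1) s = v s := fun s hs =>
    (hq s hs).derivWithin (uniqueDiffOn_unit s hs)
  have dv : ∀ s ∈ Icc (0 : ℝ) 1, derivWithin v (Icc 0 1) s = a s := fun s hs =>
    (hv s hs).derivWithin (uniqueDiffOn_unit s hs)
  rw [show (2 : WithTop ℕ∞) = 1 + 1 by norm_num, contDiffOn_succ_iff_derivWithin uniqueDiffOn_unit]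
  refine ⟨fun s hs => (hq s hs).differentiableWithinAt, by simp, ContDiffOn.congr ?_ dq⟩
  rw [show (1 : WithTop ℕ∞) = 0 + 1 by norm_num, contDiffOn_succ_iff_derivWithin uniqueDiffOn_unit]
  refine ⟨fun s hs => (hv s hs).differentiableWithinAt, by simp, ?_⟩
  exact contDiffOn_zero.2 (ha.congr dv)

/-- The second derivative of `q` along a geodesic, as a function of `q`, `q̇` and `p`. -/
def geodesicAccel (q v p : L2) : L2 :=
  mulL2 (etaB q * primL2 v) p + mulL2 (etaB q) (-incl (forceB q v))

theorem continuous_geodesicAccel :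
    Continuous fun z : L2 × L2 × L2 => geodesicAccel z.1 z.2.1 z.2.2 := by
  have h : Continuous fun z : L2 × L2 × L2 => forceB z.1 z.2.1 :=
    continuous_forceB.comp (f := fun z : L2 × L2 × L2 => (z.1, z.2.1)) (by fun_prop)
  unfold geodesicAccel
  fun_prop

theorem continuousOn_comp_triple {f : L2 → L2 → L2 → L2}
    (hf : Continuous fun z : L2 × L2 × L2 => f z.1 z.2.1 z.2.2) {q v p : ℝ → L2} {s : Set ℝ}
    (hq : ContinuousOn q s) (hv : ContinuousOn v s) (hp : ContinuousOn p s) :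
    ContinuousOn (fun t => f (q t) (v t) (p t)) s := by
  have h := hq.prodMk (hv.prodMk hp)
  exact hf.comp_continuousOn h

/-- Bootstrap: `q̇ = η(q) p` is a product of differentiable curves, and the equation for `ṗ`
expresses its derivative continuously in `q`, `q̇`, `p`. -/
theorem IsGeodesic.exists_derivs {γ : Path} (hγ : IsGeodesic γ) :
    ∃ v a : ℝ → L2, (∀ s ∈ Icc (0 : ℝ) 1, HasDerivWithinAt γ.q (v s) (Icc 0 1) s) ∧
      (∀ s ∈ Icc (0 : ℝ) 1, HasDerivWithinAt v (a s) (Icc 0 1) s) ∧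
      ContinuousOn a (Icc 0 1) ∧ ∀ s ∈ Icc (0 : ℝ) 1, accel (γ.q s) (v s) (a s) = 0 := by
  obtain ⟨hF, hG⟩ := hγ
  let v : ℝ → L2 := fun s => mulL2 (etaB (γ.q s)) (γ.p s)
  let r : ℝ → L2 := fun s => -incl (forceB (γ.q s) (v s))
  have hq : ∀ s ∈ Icc (0 : ℝ) 1, HasDerivWithinAt γ.q (v s) (Icc 0 1) s := fun s hs => by
    obtain ⟨w, hw, hw'⟩ := hF s hs
    rwa [eq_mulL2_etaB_iff.1 hw'] at hw
  have hr : ∀ s ∈ Icc (0 : ℝ) 1, HasDerivWithinAt γ.p (r s) (Icc 0 1) s := fun s hs => by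
    obtain ⟨w, hw, hw'⟩ := hG s hs
    have : w = r s := by
      refine Lp.ext ?_
      filter_upwards [hw', Lp.coeFn_neg (incl (forceB (γ.q s) (v s))),
        incl_ae (forceB (γ.q s) (v s)),
        ae_unit fun x hx => forceB_apply (hF.velocity_ae hs (hq s hs)) hx] with x h1 h2 h3 h4
      rw [h1, h2, Pi.neg_apply, h3, h4]
      ring
    rwa [← this]
  have hv : ∀ s ∈ Icc (0 : ℝ) 1, HasDerivWithinAt v
      (geodesicAccel (γ.q s) (v s) (γ.p s)) (Icc 0 1) s := fun s hs => 
    hasDerivWithinAt_mulL2 (hasDerivWithinAt_etaB (hq s hs)) (hr s hs)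
  refine ⟨v, fun s => geodesicAccel (γ.q s) (v s) (γ.p s), hq, hv, ?_, fun s hs => ?_⟩
  · have cq : ContinuousOn γ.q (Icc 0 1) := fun s hs => (hq s hs).continuousWithinAt
    have cp : ContinuousOn γ.p (Icc 0 1) := fun s hs => (hr s hs).continuousWithinAt
    have cv : ContinuousOn v (Icc 0 1) := fun s hs => (hv s hs).continuousWithinAt
    exact continuousOn_comp_triple continuous_geodesicAccel cq cv cp
  · refine Lp.ext ?_
    filter_upwards [acceleration_ae hF hs hq (hv s hs), Lp.coeFn_zero ℝ 2 unitMeasure,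
      Lp.coeFn_neg (incl (forceB (γ.q s) (v s))), incl_ae (forceB (γ.q s) (v s)),
      ae_unit fun x hx => forceB_apply (hF.velocity_ae hs (hq s hs)) hx] with x h1 h2 h3 h4 h5
    rw [← h1, h2, acceleration, (hr s hs).derivWithin (uniqueDiffOn_unit s hs), h3, Pi.neg_apply,
      h4, h5, Pi.zero_apply]
    ring

/-! ### Optimality for curves with small acceleration -/

theorem abs_integral_le {q : L2} {K : ℝ} (hK : ‖primL2 q‖ ≤ K) {x : ℝ}
    (hx : x ∈ Icc (0 : ℝ) 1) : |∫ y in (0 : ℝ)..x, q y| ≤ K := by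
  rw [← primL2_apply q hx]
  exact ((primL2 q).norm_coe_le_norm x).trans hK

instance : IsProbabilityMeasure unitMeasure := ⟨by simp⟩

theorem lintegral_enorm_le (g : L2) : ∫⁻ x in Icc (0 : ℝ) 1, ‖g x‖ₑ ≤ ENNReal.ofReal ‖g‖ := by
  rw [ofReal_norm, Lp.enorm_def, ← eLpNorm_one_eq_lintegral_enorm]
  exact eLpNorm_le_eLpNorm_of_exponent_le one_le_two (Lp.aestronglyMeasurable g)

/-- Expand the square, drop `η u² ≥ 0`, bound the cross term by `2 E R |f|`, and use that the `L¹`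
norm is at most the `L²` norm on a probability space. -/
theorem lintegral_sq_le {q g : L2} {f u : ℝ → ℝ} {E R : ℝ} (hf : f =ᵐ[unitMeasure] g)
    (hE : ∀ x ∈ Icc (0 : ℝ) 1, eta q x ≤ E) (hu : ∀ x ∈ Icc (0 : ℝ) 1, |u x| ≤ R) :
    ∫⁻ x in Icc (0 : ℝ) 1, ENNReal.ofReal (eta q x * f x ^ 2) ≤
      (∫⁻ x in Icc (0 : ℝ) 1, ENNReal.ofReal (eta q x * (f x + u x) ^ 2))
        + ENNReal.ofReal (2 * E * R) * ENNReal.ofReal ‖g‖ := by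
  have h1 : (1 : ℝ) ∈ Icc (0 : ℝ) 1 := one_mem_unit
  have hE0 : 0 ≤ E := (eta_pos q 1).le.trans (hE 1 h1)
  have hR0 : 0 ≤ R := (abs_nonneg _).trans (hu 1 h1)
  calc _ ≤ ∫⁻ x in Icc (0 : ℝ) 1, (ENNReal.ofReal (eta q x * (f x + u x) ^ 2)
          + ENNReal.ofReal (2 * E * R) * ‖g x‖ₑ) := by
        refine lintegral_mono_ae ?_
        filter_upwards [hf, ae_restrict_mem measurableSet_Icc] with x hx hxI
        rw [← hx, ← ofReal_norm, ← ENNReal.ofReal_mul (by positivity),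
          ← ENNReal.ofReal_add (mul_nonneg (eta_pos q x).le (sq_nonneg _)) (by positivity)]
        refine ENNReal.ofReal_le_ofReal ?_
        have e1 : -(f x * u x) ≤ |f x| * R :=
          (neg_le_abs _).trans (by rw [abs_mul]; gcongr; exact hu x hxI)
        have e2 : eta q x * -(f x * u x) ≤ E * (|f x| * R) :=
          (mul_le_mul_of_nonneg_left e1 (eta_pos q x).le).trans
            (mul_le_mul_of_nonneg_right (hE x hxI) (by positivity))
        have e3 := mul_nonneg (eta_pos q x).le (sq_nonneg (u x))
        rw [Real.norm_eq_abs]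
        nlinarith
    _ = _ + ENNReal.ofReal (2 * E * R) * ∫⁻ x in Icc (0 : ℝ) 1, ‖g x‖ₑ := by
        -- Measurability is needed only of the error term, so none has to be proved for `u`.
        rw [lintegral_add_right' _ ((Lp.aestronglyMeasurable g).enorm.const_mul _),
          lintegral_const_mul' _ _ ENNReal.ofReal_ne_top]
    _ ≤ _ := by
        gcongr
        exact lintegral_enorm_le g

theorem optimalAtZero_of_small (P : L2 → L2 → ℝ) {γ : Path} {K E ε : ℝ} (hKE : E = Real.exp K)
    (hK : ∀ t ∈ Icc (0 : ℝ) 1, ‖primL2 (γ.q t)‖ ≤ K) {g : ℝ → L2}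
    (hg : ∀ t ∈ Icc (0 : ℝ) 1, acceleration γ t =ᵐ[unitMeasure] g t)
    (hε : ∀ t ∈ Icc (0 : ℝ) 1, ‖g t‖ ≤ ε)
    (hsmall : 2 * E * (E * (1 + E * (4 + 12 * E + 12 * E ^ 2))) * ε ≤ E⁻¹ / 4) :
    OptimalAtZero P γ := by
  intro Δ _ hΔ
  have hE0 : 0 < E := hKE ▸ Real.exp_pos K
  have hηE : ∀ t ∈ Icc (0 : ℝ) 1, ∀ x ∈ Icc (0 : ℝ) 1, eta (γ.q t) x ≤ E := fun t ht x hx => by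
    rw [hKE]
    exact Real.exp_le_exp.2 (abs_le.1 (abs_integral_le (hK t ht) hx)).2
  have hηm : ∀ z ∈ D, E⁻¹ ≤ eta (γ.q z.1) z.2 := fun z hz => by
    rw [hKE, ← Real.exp_neg]
    exact Real.exp_le_exp.2 (abs_le.1 (abs_integral_le (hK z.1 hz.1) hz.2)).1
  -- Sup-norm bound for the projected nonlocal term per unit of slice mass; the leading `E` comes
  -- from `abs_nonlocalMeas_le`.
  set B := E * (1 + E * (4 + 12 * E + 12 * E ^ 2)) with hB
  have hB0 : 0 ≤ B := by positivity
  have hε0 : 0 ≤ ε := (norm_nonneg _).trans (hε 1 one_mem_unit)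
  unfold relaxedFunctional
  refine add_le_add_left (EReal.coe_ennreal_le_coe_ennreal_iff.2 ?_) _
  rw [fisherRaoTime_zero, zero_add]
  have hz : ∫⁻ t in Icc (0 : ℝ) 1, ∫⁻ x in Icc (0 : ℝ) 1, ENNReal.ofReal
        (eta (γ.q t) x * (acceleration γ t x
          + projStar (γ.q t) (nonlocalMeas (slice 0 t) (γ.q t)) x) ^ 2)
      = ∫⁻ t in Icc (0 : ℝ) 1, ∫⁻ x in Icc (0 : ℝ) 1, ENNReal.ofReal
        (eta (γ.q t) x * acceleration γ t x ^ 2) := by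
    refine lintegral_congr_ae ((ae_restrict_of_ae slice_zero_ae).mono fun t ht => ?_)
    have h0 : ∀ x, projStar (γ.q t) (nonlocalMeas (slice 0 t) (γ.q t)) x = 0 := fun x => by
      have : nonlocalMeas (slice 0 t) (γ.q t) = fun _ => 0 := by
        funext y
        simp [nonlocalMeas, ht]
      simp [projStar, this, lift_eq]
    simp only [h0, add_zero]
  rw [hz]
  let ρ : ℝ → ℝ≥0∞ := Δ.fst.rnDeriv volume
  have hρ : ∀ᵐ t ∂(volume : Measure ℝ), ρ t < ∞ := Measure.rnDeriv_lt_top _ _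
  calc _ ≤ ∫⁻ t in Icc (0 : ℝ) 1, ((∫⁻ x in Icc (0 : ℝ) 1, ENNReal.ofReal
        (eta (γ.q t) x * (acceleration γ t x
          + projStar (γ.q t) (nonlocalMeas (slice Δ t) (γ.q t)) x) ^ 2))
        + ENNReal.ofReal (2 * E * B * ε) * ρ t) := by
        refine lintegral_mono_ae ?_
        filter_upwards [ae_restrict_of_ae hρ, ae_restrict_mem measurableSet_Icc] with t ht htI
        have hs : slice Δ t univ = ρ t := slice_univ Δ t
        have : IsFiniteMeasure (slice Δ t) := ⟨hs ▸ ht⟩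
        have hu : ∀ x ∈ Icc (0 : ℝ) 1,
            |projStar (γ.q t) (nonlocalMeas (slice Δ t) (γ.q t)) x| ≤ (ρ t).toReal * B := by
          intro x hx
          refine (abs_projStar_le (hηE t htI)
            (fun y hy => abs_nonlocalMeas_le (hηE t htI) hy) hx).trans_eq ?_
          rw [measureReal_def, hs, hB]
          ring
        refine (lintegral_sq_le (hg t htI) (hηE t htI) hu).trans ?_
        refine add_le_add le_rfl ?_
        rw [← ENNReal.ofReal_mul (by positivity)]
        calc _ ≤ ENNReal.ofReal (2 * E * B * ε * (ρ t).toReal) := by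
              refine ENNReal.ofReal_le_ofReal ?_
              calc _ ≤ 2 * E * ((ρ t).toReal * B) * ε := by
                    gcongr
                    exact hε t htI
                _ = _ := by ring
          _ = _ := by rw [ENNReal.ofReal_mul (by positivity), ENNReal.ofReal_toReal ht.ne]
    _ = (∫⁻ t in Icc (0 : ℝ) 1, ∫⁻ x in Icc (0 : ℝ) 1, ENNReal.ofReal
        (eta (γ.q t) x * (acceleration γ t x
          + projStar (γ.q t) (nonlocalMeas (slice Δ t) (γ.q t)) x) ^ 2))
        + ENNReal.ofReal (2 * E * B * ε) * ∫⁻ t in Icc (0 : ℝ) 1, ρ t := by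
        rw [lintegral_add_right _ ((Measure.measurable_rnDeriv _ _).const_mul _),
          lintegral_const_mul' _ _ ENNReal.ofReal_ne_top]
    _ ≤ (∫⁻ t in Icc (0 : ℝ) 1, ∫⁻ x in Icc (0 : ℝ) 1, ENNReal.ofReal
        (eta (γ.q t) x * (acceleration γ t x
          + projStar (γ.q t) (nonlocalMeas (slice Δ t) (γ.q t)) x) ^ 2))
        + ENNReal.ofReal (E⁻¹ / 4) * Δ univ := by
        gcongr
        -- A singular part of the time marginal is lost here, which only helps: `∫ ρ ≤ Δ(D)`
        -- suffices.
        exact (Measure.setLIntegral_rnDeriv_le _).trans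
          ((measure_mono (subset_univ _)).trans_eq Measure.fst_univ)
    _ ≤ _ := by
        rw [add_comm]
        gcongr
        exact mul_mass_le_fisherRaoTime hΔ (by positivity) hηm

/-! ### The `C²` neighborhood of a geodesic. -/

/-- The two-jet of a `C²` curve. -/
def jetMap (q : C2Curve) : C(Icc (0 : ℝ) 1, L2 × L2 × L2) :=
  (q.jet 0).prodMk ((q.jet 1).prodMk (q.jet 2))

/-- The smallness condition couples the three derivatives at the same time, so they are paired into
one map; currying gives continuity for the compact-open topology. -/
theorem continuous_jetMap : Continuous jetMap := by
  have cj : Continuous C2Curve.jet := continuous_induced_dom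
  have h : ∀ k : Fin 3, Continuous fun z : C2Curve × Icc (0 : ℝ) 1 => z.1.jet k z.2 := fun k =>
    (((continuous_apply k).comp cj).comp continuous_fst).eval continuous_snd
  exact ContinuousMap.continuous_of_continuous_uncurry _ ((h 0).prodMk ((h 1).prodMk (h 2)))

theorem jetMap_apply {q : ℝ → L2} (h : ContDiffOn ℝ 2 q (Icc 0 1)) (t : Icc (0 : ℝ) 1) :
    jetMap ⟨q, h⟩ t = (q t, derivWithin q (Icc 0 1) t,
      derivWithin (derivWithin q (Icc 0 1)) (Icc 0 1) t) := by
  change (iteratedDerivWithin 0 q (Icc 0 1) t, iteratedDerivWithin 1 q (Icc 0 1) t,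
    iteratedDerivWithin 2 q (Icc 0 1) t) = _
  rw [iteratedDerivWithin_succ (n := 1), iteratedDerivWithin_one, iteratedDerivWithin_zero]

theorem containsC2Neighborhood_of_isGeodesic (P : L2 → L2 → ℝ) {C : Set Path}
    (hC : ∀ γ ∈ C, FirstEquation γ) {γ : Path} (hγ : IsGeodesic γ) :
    ContainsC2Neighborhood C {γ' ∈ C | OptimalAtZero P γ'} γ := by
  obtain ⟨v, a, hq, hv, ha, hacc⟩ := hγ.exists_derivs
  have h2 : ContDiffOn ℝ 2 γ.q (Icc 0 1) := contDiffOn_two_of_hasDerivWithinAt hq hv ha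
  have cq : ContinuousOn γ.q (Icc 0 1) := h2.continuousOn
  obtain ⟨K, hK⟩ := isCompact_Icc.exists_bound_of_continuousOn
    (primL2.continuous.comp_continuousOn cq)
  -- `K + 1` rather than `K` leaves room for nearby curves, so that the bound defines an open
  -- condition.
  obtain ⟨E, hE⟩ : ∃ E, E = Real.exp (K + 1) := ⟨_, rfl⟩
  have hE0 : 0 < E := hE ▸ Real.exp_pos _
  have hB : 0 < 2 * E * (E * (1 + E * (4 + 12 * E + 12 * E ^ 2))) := by positivity
  -- The value that turns the smallness hypothesis of `optimalAtZero_of_small` into an equality.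
  obtain ⟨ε, hε⟩ : ∃ ε, ε = E⁻¹ / 4 / (2 * E * (E * (1 + E * (4 + 12 * E + 12 * E ^ 2)))) :=
    ⟨_, rfl⟩
  have hε0 : 0 < ε := by rw [hε]; positivity
  let W : Set (L2 × L2 × L2) := {z | ‖primL2 z.1‖ < K + 1 ∧ ‖accel z.1 z.2.1 z.2.2‖ < ε}
  have hW : IsOpen W :=
    (isOpen_lt (primL2.continuous.comp continuous_fst).norm continuous_const).inter
      (isOpen_lt continuous_accel.norm continuous_const)
  -- As `[0,1]` is compact, sending it into the open set `W` is an open condition for uniform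
  -- convergence.
  refine ⟨h2, {q | MapsTo (jetMap q) univ W},
    (ContinuousMap.isOpen_setOfPred_mapsTo isCompact_univ hW).preimage continuous_jetMap, ?_, ?_⟩
  · rintro t -
    have e1 : ∀ s ∈ Icc (0 : ℝ) 1, derivWithin γ.q (Icc 0 1) s = v s := fun s hs =>
      (hq s hs).derivWithin (uniqueDiffOn_unit s hs)
    have e2 : derivWithin (derivWithin γ.q (Icc 0 1)) (Icc 0 1) t = a t := by
      rw [derivWithin_congr e1 (e1 t t.2)]
      exact (hv t t.2).derivWithin (uniqueDiffOn_unit t t.2)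
    refine mem_of_eq_of_mem (jetMap_apply h2 t) ⟨(hK t t.2).trans_lt (lt_add_one K), ?_⟩
    rw [e1 t t.2, e2, hacc t t.2, norm_zero]
    exact hε0
  · intro γ' hγ' h' hU
    refine ⟨hγ', ?_⟩
    have d0 : ∀ s ∈ Icc (0 : ℝ) 1,
        HasDerivWithinAt γ'.q (derivWithin γ'.q (Icc 0 1) s) (Icc 0 1) s := fun s hs =>
      (h'.differentiableOn two_ne_zero s hs).hasDerivWithinAt
    have d1 : ∀ s ∈ Icc (0 : ℝ) 1, HasDerivWithinAt (derivWithin γ'.q (Icc 0 1))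
        (derivWithin (derivWithin γ'.q (Icc 0 1)) (Icc 0 1) s) (Icc 0 1) s := fun s hs =>
      ((h'.derivWithin uniqueDiffOn_unit (m := 1) (by norm_num)).differentiableOn one_ne_zero s
        hs).hasDerivWithinAt
    have hb : ∀ t ∈ Icc (0 : ℝ) 1, ‖primL2 (γ'.q t)‖ < K + 1 ∧
        ‖accel (γ'.q t) (derivWithin γ'.q (Icc 0 1) t)
          (derivWithin (derivWithin γ'.q (Icc 0 1)) (Icc 0 1) t)‖ < ε := fun t ht =>
      (mem_of_eq_of_mem (jetMap_apply h' ⟨t, ht⟩).symm (hU (mem_univ _)) : (_, _, _) ∈ W)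
    refine optimalAtZero_of_small P hE (fun t ht => (hb t ht).1.le)
      (fun t ht => acceleration_ae (hC γ' hγ') ht d0 (d1 t ht)) (fun t ht => (hb t ht).2.le) ?_
    rw [hε, mul_div_cancel₀ _ hB.ne']

end

end DiffSpline

theorem mainTheorem11
    (P : DiffSpline.L2 → DiffSpline.L2 → ℝ)
    (p₀ q₀ p₁ q₁ : DiffSpline.L2)
    (C : Set DiffSpline.Path)
    (hC : C = DiffSpline.curves0 p₀ q₀ ∨ C = DiffSpline.curves01 p₀ q₀ p₁ q₁)
    (γ : DiffSpline.Path) (hγC : γ ∈ C) (hγ : DiffSpline.IsGeodesic γ) :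
    DiffSpline.ContainsC2Neighborhood C {γ' ∈ C | DiffSpline.OptimalAtZero P γ'} γ := by
  refine DiffSpline.containsC2Neighborhood_of_isGeodesic P (fun γ' hγ' => ?_) hγ
  rcases hC with rfl | rfl
  · exact hγ'.2.2.1
  · exact hγ'.1.2.2.1
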